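/- For a finite group $G=\{g_1,\dots,g_n\}$ and integers $x_g$ $(g\in G)$, let $\mathscr D_G(x_{g_1},\dots,x_{g_n})=\det\bigl(x_{g_ig_j^{-1}}\bigr)_{1\le i,j\le n}$ be the integer group determinant, let $S(G)=\{\mathscr D_G(x_{g_1},\dots,x_{g_n}) : x_{g_1},\dots,x_{g_n}\in\mathbb Z\}$ be the set of its values, and let $$\lambda(G)=\min\{|s| : s\in S(G),\ s\neq 0,\pm1\}$$ be the Lind–Lehmer constant of $G$. Then $$\lambda(D_{12})=\lambda(Q_{12})=\lambda(\mathbb Z_{12})=\lambda(A_4)=5,\qquad \lambda(\mathbb Z_6\times\mathbb Z_2)=11,$$ where $D_{12}$ and $Q_{12}=\langle a,b : a^6=1,\ b^2=a^3,\ ab=ba^{-1}\rangle$ are the dihedral and dicyclic groups of order $12$, $\mathbb Z_n$ is the cyclic group of order $n$, and $A_4$ is the alternating group on four letters. -/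

import Mathlib

/-- The group matrix of a finite group `G` at integers `x_g`, with `(g, h)` entry `x_{g h⁻¹}`. -/
def groupMatrix {G : Type*} [Group G] (x : G → ℤ) : Matrix G G ℤ :=
  Matrix.of fun g h => x (g * h⁻¹)

/-- The group determinant of `G` at the integers `x_g`. -/
def groupDet {G : Type*} [Group G] [Fintype G] [DecidableEq G] (x : G → ℤ) : ℤ :=
  (groupMatrix x).det

/-- The set of values of the group determinant of `G` at integer arguments. -/
def integerGroupDets (G : Type*) [Group G] [Fintype G] [DecidableEq G] : Set ℤ :=
  {s | ∃ x : G → ℤ, groupDet x = s}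

/-- `IsLindLehmerConstant G l` says that `l` is the minimum of the absolute values `|s|`, where `s`
runs through the integer group determinants of `G` other than `0` and `±1`. -/
def IsLindLehmerConstant (G : Type*) [Group G] [Fintype G] [DecidableEq G] (l : ℤ) : Prop :=
  IsLeast {t : ℤ | ∃ s ∈ integerGroupDets G, s ≠ 0 ∧ s ≠ 1 ∧ s ≠ -1 ∧ t = |s|} l

/-!
The group determinant at `x` is the determinant of multiplication by `α = ∑ x_g g` on `ℤ[G]`.

Lower bounds come from subgroups. As `ℤ[G]` is free over `ℤ[H]` for a subgroup `H`, transitivity of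
determinants shows that for commutative `H` every integer group determinant of `G` is one of `H`
(`groupDet_mem_integerGroupDets_of_injective`). All five groups contain a commutative subgroup of
order `4`, whose even determinants are divisible by `16`, and one of order `3`, whose determinants
divisible by `3` are divisible by `9`. This excludes `±2`, `±3` and `±4`.

The value `±5` is attained by an `α` of augmentation `5` that has a partner `β` of augmentation `5`
with `α β = 1 + 2 N`, where `N` is the sum of the group elements (`abs_groupDet_eq_five`). The
equation is checked by evaluation, and no determinant of size `12` has to be computed.

For `ℤ₆ × ℤ₂ ≅ C₃ × C₂ × C₂` only odd values have to be considered. The determinant is then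
`A * norm U` with an integer `A` and an Eisenstein integer `U` that are congruent modulo `1 - ω`. Both
are determinants of the Klein four-group, hence fourth powers modulo `4`
(`exists_mul_eq_pow_four_add`), and these congruences leave no value of absolute value below `11`
except `1` (`eleven_le_abs_mul_norm`). The element `1 - N` has determinant `-11`.
-/

open Matrix

/-! ### Multiplicativity and augmentation -/

/-- The group determinant turns the convolution product of `ℤ[G]` into a product. -/
theorem groupDet_mul_groupDet {G : Type*} [Group G] [Fintype G] [DecidableEq G] {x y z : G → ℤ}
    (h : ∀ g, ∑ k, x (g * k⁻¹) * y k = z g) : groupDet x * groupDet y = groupDet z := by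
  rw [groupDet, groupDet, groupDet, ← det_mul]
  congr 1
  ext g k
  simp only [groupMatrix, mul_apply, of_apply, ← h]
  refine Fintype.sum_equiv (Equiv.mulRight k⁻¹) _ _ fun l => ?_
  simp [mul_assoc]

theorem groupDet_one_add_const {G : Type*} [Group G] [Fintype G] [DecidableEq G] (m : ℤ) :
    groupDet (fun g : G => (if g = 1 then 1 else 0) + m) = 1 + m * Fintype.card G := by
  have : groupMatrix (fun g : G => (if g = 1 then 1 else 0) + m) =
      1 + replicateCol Unit (fun _ : G => m) * replicateRow Unit (fun _ : G => (1 : ℤ)) := by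
    ext g h
    simp [groupMatrix, one_apply, mul_apply, mul_inv_eq_one]
  rw [groupDet, this, det_one_add_replicateCol_mul_replicateRow]
  simp [dotProduct, mul_comm]

/-- The augmentation divides the group determinant, because the constant vector `1` is an
eigenvector of the group matrix with the augmentation as its eigenvalue. -/
theorem sum_dvd_groupDet {G : Type*} [Group G] [Fintype G] [DecidableEq G] (x : G → ℤ) :
    ∑ g, x g ∣ groupDet x := by
  have h : groupMatrix x *ᵥ 1 = (∑ g, x g) • (1 : G → ℤ) := by
    ext g
    simp only [groupMatrix, mulVec, dotProduct, of_apply, Pi.one_apply, mul_one, Pi.smul_apply,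
      smul_eq_mul]
    exact Fintype.sum_equiv ((Equiv.inv G).trans (Equiv.mulLeft g)) _ _ fun k => by simp
  have h2 := congrArg (fun v => ((groupMatrix x).adjugate *ᵥ v) 1) h
  simp only [mulVec_mulVec, adjugate_mul, smul_mulVec, one_mulVec, mulVec_smul, Pi.smul_apply,
    Pi.one_apply, smul_eq_mul, mul_one] at h2
  exact ⟨_, h2⟩

/-- Let `N` be the sum of all elements of a group of order `12`. If `α β = 1 + 2 N` in `ℤ[G]`, then
the determinants of `α` and `β` multiply to `1 + 2 * 12 = 25`; if both augmentations are `5`, then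
both determinants are divisible by `5`, so they are `5` up to sign. -/
theorem abs_groupDet_eq_five {G : Type*} [Group G] [Fintype G] [DecidableEq G] (x y : G → ℤ)
    (hG : Fintype.card G = 12) (hx : ∑ g, x g = 5) (hy : ∑ g, y g = 5)
    (h : ∀ g, ∑ k, x (g * k⁻¹) * y k = (if g = 1 then 1 else 0) + 2) : |groupDet x| = 5 := by
  have hxy := groupDet_mul_groupDet h
  rw [groupDet_one_add_const, hG] at hxy
  obtain ⟨a, ha⟩ := hx ▸ sum_dvd_groupDet x
  obtain ⟨b, hb⟩ := hy ▸ sum_dvd_groupDet y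
  rw [ha, hb] at hxy
  have hab : a * b = 1 := by push_cast at hxy; linarith
  rw [ha, abs_mul, Int.isUnit_iff_abs_eq.mp (IsUnit.of_mul_eq_one b hab)]
  norm_num

/-! ### Restriction to commutative subgroups -/

/-- The ring of group matrices of `H`, a copy of `ℤ[H]` inside the matrix ring. -/
def groupMatrixSubring (H : Type*) [Group H] [Fintype H] [DecidableEq H] :
    Subring (Matrix H H ℤ) where
  carrier := Set.range groupMatrix
  mul_mem' := by
    rintro _ _ ⟨x, rfl⟩ ⟨y, rfl⟩
    refine ⟨fun g => ∑ k, x (g * k⁻¹) * y k, ?_⟩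
    ext g k
    simp only [groupMatrix, mul_apply, of_apply]
    exact (Fintype.sum_equiv (Equiv.mulRight k⁻¹) _ _ fun l => by simp [mul_assoc]).symm
  one_mem' := ⟨Pi.single 1 1, by ext g h; simp [groupMatrix, one_apply, Pi.single_apply,
    mul_inv_eq_one]⟩
  add_mem' := by rintro _ _ ⟨x, rfl⟩ ⟨y, rfl⟩; exact ⟨x + y, rfl⟩
  zero_mem' := ⟨0, rfl⟩
  neg_mem' := by rintro _ ⟨x, rfl⟩; exact ⟨-x, rfl⟩

instance groupMatrixSubring.instCommRing (H : Type*) [CommGroup H] [Fintype H] [DecidableEq H] :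
    CommRing (groupMatrixSubring H) where
  mul_comm := by
    rintro ⟨_, x, rfl⟩ ⟨_, y, rfl⟩
    ext g k
    simp only [groupMatrix, MulMemClass.mk_mul_mk, mul_apply, of_apply]
    refine Fintype.sum_equiv ((Equiv.inv H).trans (Equiv.mulRight (g * k))) _ _ fun l => ?_
    rw [mul_comm]
    congr 2
    · simp [mul_assoc, mul_left_comm g, mul_comm l]
    · simp [mul_comm]

/-- An integer group determinant of `G` is one of every commutative group `H` embedded in `G`: along
left cosets of `H` the group matrix of `G` splits into blocks that are group matrices of `H`, these
commute, and the determinant over the ring of group matrices of `H` is again such a matrix. -/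
theorem groupDet_mem_integerGroupDets_of_injective {G H : Type*} [Group G] [Fintype G]
    [DecidableEq G] [CommGroup H] [Fintype H] [DecidableEq H] (f : H →* G)
    (hf : Function.Injective f) (x : G → ℤ) : groupDet x ∈ integerGroupDets H := by
  classical
  let φ : (G ⧸ f.range) × H → G := fun p => p.1.out * f p.2
  have hφ : Function.Bijective φ := by
    constructor
    · rintro ⟨t, h⟩ ⟨t', h'⟩ hp
      have ht : t = t' := by
        rw [← QuotientGroup.out_eq' t, ← QuotientGroup.out_eq' t']
        rw [QuotientGroup.eq]
        refine ⟨h * h'⁻¹, ?_⟩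
        have hp' : t.out * f h = t'.out * f h' := hp
        rw [map_mul, map_inv, eq_inv_mul_iff_mul_eq, ← mul_assoc, hp']
        simp
      subst ht
      exact Prod.ext rfl (hf (mul_left_cancel hp))
    · intro g
      obtain ⟨h, hh⟩ : (g : G ⧸ f.range).out⁻¹ * g ∈ f.range := by
        rw [← QuotientGroup.eq, QuotientGroup.out_eq']
      exact ⟨(g, h), by simp [φ, hh]⟩
  let e := Equiv.ofBijective φ hφ
  let M : Matrix (G ⧸ f.range) (G ⧸ f.range) (groupMatrixSubring H) :=
    Matrix.of fun t t' => ⟨groupMatrix fun h => x (t.out * f h * t'.out⁻¹), _, rfl⟩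
  have hM : (groupMatrix x).submatrix e e =
      (M.map (groupMatrixSubring H).subtype).comp _ _ _ _ ℤ := by
    ext ⟨t, h⟩ ⟨t', h'⟩
    simp [groupMatrix, M, e, φ, comp_apply, mul_assoc]
  obtain ⟨y, hy⟩ := M.det.2
  refine ⟨y, ?_⟩
  rw [groupDet, groupDet, hy, ← det_submatrix_equiv_self e, hM]
  exact Matrix.det_det M (groupMatrixSubring H).subtype

/-! ### Determinants of small abelian groups -/

theorem groupDet_prod_two {K : Type*} [Group K] [Fintype K] [DecidableEq K]
    (x : K × Multiplicative (ZMod 2) → ℤ) :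
    groupDet x = groupDet (fun k => x (k, .ofAdd 0) + x (k, .ofAdd 1)) *
      groupDet (fun k => x (k, .ofAdd 0) - x (k, .ofAdd 1)) := by
  let e : K ⊕ K ≃ K × Multiplicative (ZMod 2) :=
    { toFun := Sum.elim (fun k => (k, .ofAdd 0)) (fun k => (k, .ofAdd 1))
      invFun := fun p => if p.2 = .ofAdd 0 then .inl p.1 else .inr p.1
      left_inv := by rintro (k | k) <;> simp
      right_inv := by
        rintro ⟨k, i⟩
        obtain rfl | rfl : i = .ofAdd 0 ∨ i = .ofAdd 1 := by revert i; decide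
        all_goals simp }
  set A := groupMatrix fun k => x (k, .ofAdd 0) with hA
  set B := groupMatrix fun k => x (k, .ofAdd 1) with hB
  have h : (groupMatrix x).submatrix e e = fromBlocks A B B A := by
    have h00 : (.ofAdd 0 * (.ofAdd 0)⁻¹ : Multiplicative (ZMod 2)) = .ofAdd 0 := by decide
    have h01 : (.ofAdd 0 * (.ofAdd 1)⁻¹ : Multiplicative (ZMod 2)) = .ofAdd 1 := by decide
    have h10 : (.ofAdd 1 * (.ofAdd 0)⁻¹ : Multiplicative (ZMod 2)) = .ofAdd 1 := by decide
    have h11 : (.ofAdd 1 * (.ofAdd 1)⁻¹ : Multiplicative (ZMod 2)) = .ofAdd 0 := by decide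
    ext (k | k) (l | l) <;>
      simp only [groupMatrix, submatrix_apply, of_apply, e, Equiv.coe_fn_mk, Sum.elim_inl,
        Sum.elim_inr, Prod.inv_mk, Prod.mk_mul_mk, h00, h01, h10, h11, hA, hB, fromBlocks_apply₁₁,
        fromBlocks_apply₁₂, fromBlocks_apply₂₁, fromBlocks_apply₂₂]
  -- Adding the second block row to the first and then subtracting the first block column from
  -- the second makes the matrix block triangular.
  have hmul : fromBlocks 1 1 0 1 * fromBlocks A B B A * fromBlocks 1 (-1) 0 1 =
      fromBlocks (A + B) 0 B (A - B) := by
    rw [fromBlocks_multiply, fromBlocks_multiply]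
    simp only [one_mul, mul_one, zero_mul, mul_zero, zero_add, add_zero, mul_neg]
    congr 1 <;> abel
  have hdet := congrArg det hmul
  rw [det_mul, det_mul, det_fromBlocks_zero₂₁, det_fromBlocks_zero₂₁, det_fromBlocks_zero₁₂] at hdet
  simp only [det_one, one_mul, mul_one] at hdet
  rw [groupDet, ← det_submatrix_equiv_self e, h, hdet]
  rfl

theorem groupDet_multiplicative_zmod_two (x : Multiplicative (ZMod 2) → ℤ) :
    groupDet x = (x (.ofAdd 0) + x (.ofAdd 1)) * (x (.ofAdd 0) - x (.ofAdd 1)) := by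
  have h : groupDet x = x (.ofAdd 0) * x (.ofAdd 0) - x (.ofAdd 1) * x (.ofAdd 1) :=
    Matrix.det_fin_two _
  rw [h]; ring

theorem groupDet_multiplicative_zmod_three (x : Multiplicative (ZMod 3) → ℤ) :
    groupDet x = (x (.ofAdd 0) + x (.ofAdd 1) + x (.ofAdd 2)) *
      (x (.ofAdd 0) ^ 2 + x (.ofAdd 1) ^ 2 + x (.ofAdd 2) ^ 2 - x (.ofAdd 0) * x (.ofAdd 1) -
        x (.ofAdd 1) * x (.ofAdd 2) - x (.ofAdd 2) * x (.ofAdd 0)) := by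
  set a := x (.ofAdd 0) with ha
  set b := x (.ofAdd 1) with hb
  set c := x (.ofAdd 2) with hc
  have h : groupMatrix x = (!![a, c, b; b, a, c; c, b, a] : Matrix (Fin 3) (Fin 3) ℤ) := by
    ext i j
    fin_cases i <;> fin_cases j <;> rfl
  have h' : groupDet x = (!![a, c, b; b, a, c; c, b, a] : Matrix (Fin 3) (Fin 3) ℤ).det :=
    congrArg (Matrix.det (n := Fin 3)) h
  rw [h', det_fin_three]
  simp
  ring

theorem groupDet_multiplicative_zmod_four (x : Multiplicative (ZMod 4) → ℤ) :
    groupDet x =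
      ((x (.ofAdd 0) + x (.ofAdd 2)) ^ 2 - (x (.ofAdd 1) + x (.ofAdd 3)) ^ 2) *
      ((x (.ofAdd 0) - x (.ofAdd 2)) ^ 2 + (x (.ofAdd 1) - x (.ofAdd 3)) ^ 2) := by
  set a := x (.ofAdd 0) with ha
  set b := x (.ofAdd 1) with hb
  set c := x (.ofAdd 2) with hc
  set d := x (.ofAdd 3) with hd
  have h : groupMatrix x =
      (!![a, d, c, b; b, a, d, c; c, b, a, d; d, c, b, a] : Matrix (Fin 4) (Fin 4) ℤ) := by
    ext i j
    fin_cases i <;> fin_cases j <;> rfl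
  have h' : groupDet x =
      (!![a, d, c, b; b, a, d, c; c, b, a, d; d, c, b, a] : Matrix (Fin 4) (Fin 4) ℤ).det :=
    congrArg (Matrix.det (n := Fin 4)) h
  rw [h', det_succ_row_zero]
  simp [Fin.sum_univ_succ, det_fin_three, submatrix, Fin.succAbove]
  ring

/-- The four factors of the determinant are congruent modulo `2`, so they are all even as soon as
one of them is. -/
theorem sixteen_dvd_groupDet_klein (x : Multiplicative (ZMod 2) × Multiplicative (ZMod 2) → ℤ)
    (h : 2 ∣ groupDet x) : 16 ∣ groupDet x := by
  rw [groupDet_prod_two, groupDet_multiplicative_zmod_two, groupDet_multiplicative_zmod_two] at *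
  generalize x (.ofAdd 0, .ofAdd 0) = a at *
  generalize x (.ofAdd 1, .ofAdd 0) = b at *
  generalize x (.ofAdd 0, .ofAdd 1) = c at *
  generalize x (.ofAdd 1, .ofAdd 1) = d at *
  simp only [Int.prime_two.dvd_mul] at h
  obtain ⟨k, hk⟩ : 2 ∣ a + c + (b + d) := by omega
  refine ⟨k * (k - b - d) * (k - c - d) * (k - b - c), ?_⟩
  obtain rfl : a = 2 * k - c - b - d := by linarith
  ring

theorem sixteen_dvd_groupDet_zmod_four (x : Multiplicative (ZMod 4) → ℤ)
    (h : 2 ∣ groupDet x) : 16 ∣ groupDet x := by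
  rw [groupDet_multiplicative_zmod_four] at *
  generalize x (.ofAdd 0) = a at *
  generalize x (.ofAdd 1) = b at *
  generalize x (.ofAdd 2) = c at *
  generalize x (.ofAdd 3) = d at *
  obtain ⟨k, hk⟩ : 2 ∣ a + b + c + d := by
    rw [← even_iff_two_dvd] at h ⊢
    simp only [Int.even_mul, Int.even_add, Int.even_sub, Int.even_pow] at h ⊢
    tauto
  obtain rfl : a = 2 * k - b - c - d := by linarith
  -- The determinant is `8` times this integer.
  have key : ∃ l, (k - b - d) * ((k - c - d) ^ 2 + (k - b - c) ^ 2) * k = 2 * l := by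
    rw [← dvd_def, ← even_iff_two_dvd]
    simp only [Int.even_mul, Int.even_add, Int.even_sub, Int.even_pow]
    tauto
  obtain ⟨l, hl⟩ := key
  exact ⟨l, by linear_combination 8 * hl⟩

theorem nine_dvd_groupDet_zmod_three (x : Multiplicative (ZMod 3) → ℤ)
    (h : 3 ∣ groupDet x) : 9 ∣ groupDet x := by
  rw [groupDet_multiplicative_zmod_three] at *
  generalize x (.ofAdd 0) = a at *
  generalize x (.ofAdd 1) = b at *
  generalize x (.ofAdd 2) = c at *
  obtain ⟨k, hk⟩ : 3 ∣ a + b + c := by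
    rcases Int.prime_three.dvd_or_dvd h with h | h
    · exact h
    · refine Int.prime_three.dvd_of_dvd_pow (n := 2) ?_
      obtain ⟨k, hk⟩ := h
      exact ⟨k + a * b + b * c + c * a, by linear_combination hk⟩
  exact ⟨k * (3 * k ^ 2 - a * b - b * c - c * a), by
    obtain rfl : a = 3 * k - b - c := by linarith
    ring⟩

theorem groupDet_mem_integerGroupDets_zmod {G : Type*} [Group G] [Fintype G] [DecidableEq G]
    {n : ℕ} [NeZero n] {a : G} (ha : orderOf a = n) (x : G → ℤ) :
    groupDet x ∈ integerGroupDets (Multiplicative (ZMod n)) := by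
  refine groupDet_mem_integerGroupDets_of_injective
    (MonoidHom.mk' (fun i : Multiplicative (ZMod n) => a ^ i.toAdd.val) fun i j => ?_) ?_ x
  · rw [← pow_add, pow_eq_pow_iff_modEq, ha, toAdd_mul, ZMod.val_add]
    exact Nat.mod_modEq _ _
  · intro i j hij
    have hij' : a ^ i.toAdd.val = a ^ j.toAdd.val := hij
    rw [pow_inj_mod, ha, Nat.mod_eq_of_lt (ZMod.val_lt _), Nat.mod_eq_of_lt (ZMod.val_lt _)] at hij'
    exact ZMod.val_injective n hij'

theorem groupDet_mem_integerGroupDets_klein {G : Type*} [Group G] [Fintype G] [DecidableEq G]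
    {a b : G} (ha : orderOf a = 2) (hb : orderOf b = 2) (hab : a * b = b * a) (hne : a ≠ b)
    (x : G → ℤ) :
    groupDet x ∈ integerGroupDets (Multiplicative (ZMod 2) × Multiplicative (ZMod 2)) := by
  have ha2 : a * a = 1 := by rw [← sq, ← ha, pow_orderOf_eq_one]
  have hb2 : b * b = 1 := by rw [← sq, ← hb, pow_orderOf_eq_one]
  have hab2 : a * b ≠ 1 := fun h => hne (mul_right_cancel (h.trans hb2.symm))
  have ha1 : a ≠ 1 := fun h => by simp [h] at ha
  have hb1 : b ≠ 1 := fun h => by simp [h] at hb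
  have key : ∀ c : G, c * c = 1 → ∀ i j : ZMod 2, c ^ (i + j).val = c ^ i.val * c ^ j.val := by
    intro c hc i j
    rw [← pow_add, ZMod.val_add, ← pow_mod_orderOf c ((i.val + j.val) % 2),
      ← pow_mod_orderOf c (i.val + j.val),
      Nat.mod_mod_of_dvd _ (orderOf_dvd_of_pow_eq_one (by rw [sq, hc]))]
  refine groupDet_mem_integerGroupDets_of_injective (MonoidHom.mk'
    (fun p : Multiplicative (ZMod 2) × Multiplicative (ZMod 2) =>
      a ^ p.1.toAdd.val * b ^ p.2.toAdd.val) fun p q => ?_) ?_ x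
  · have hc : Commute a b := hab
    simp only [Prod.fst_mul, Prod.snd_mul, toAdd_mul, key a ha2, key b hb2]
    exact (hc.pow_pow _ _).mul_mul_mul_comm _ _
  · rw [injective_iff_map_eq_one]
    rintro ⟨i, j⟩ hij
    have h01 : ∀ i : Multiplicative (ZMod 2), i = .ofAdd 0 ∨ i = .ofAdd 1 := by decide
    obtain rfl | rfl := h01 i <;> obtain rfl | rfl := h01 j
    all_goals simp_all [ZMod.val_one]

/-! ### The groups with constant `5` -/

/-- The criterion for the groups with Lind–Lehmer constant `5`: `h2` excludes `±2` and `±4`, an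
element of order `3` excludes `±3`, and `h` provides the value `±5`. -/
theorem isLindLehmerConstant_five {G : Type*} [Group G] [Fintype G] [DecidableEq G]
    (h2 : ∀ s ∈ integerGroupDets G, 2 ∣ s → 16 ∣ s)
    {a : G} (ha : orderOf a = 3) {x y : G → ℤ}
    (hG : Fintype.card G = 12) (hx : ∑ g, x g = 5) (hy : ∑ g, y g = 5)
    (h : ∀ g, ∑ k, x (g * k⁻¹) * y k = (if g = 1 then 1 else 0) + 2) :
    IsLindLehmerConstant G 5 := by
  have hx5 := abs_groupDet_eq_five x y hG hx hy h
  refine ⟨⟨groupDet x, ⟨x, rfl⟩, ?_, ?_, ?_, hx5.symm⟩, ?_⟩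
  · intro h0; simp [h0] at hx5
  · intro h0; simp [h0] at hx5
  · intro h0; simp [h0] at hx5
  rintro _ ⟨s, ⟨z, rfl⟩, h0, h1, h1', rfl⟩
  have h16 := h2 _ ⟨z, rfl⟩
  have h9 : 3 ∣ groupDet z → 9 ∣ groupDet z := by
    obtain ⟨y, hy⟩ := groupDet_mem_integerGroupDets_zmod ha z
    exact hy ▸ nine_dvd_groupDet_zmod_three y
  by_contra hlt
  rw [not_le, abs_lt] at hlt
  omega

open DihedralGroup in
theorem isLindLehmerConstant_dihedralGroup_six : IsLindLehmerConstant (DihedralGroup 6) 5 := by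
  refine isLindLehmerConstant_five (a := r 2)
    (x := fun | r i => ![0, 0, 0, 0, 1, 1] i | sr i => ![0, 0, 0, 1, 1, 1] i)
    (y := fun | r i => ![0, 0, 0, 0, 1, 1] i | sr i => ![0, 0, 0, 1, 1, 1] i)
    ?_ ?_ ?_ ?_ ?_ ?_
  · rintro _ ⟨x, rfl⟩
    obtain ⟨y, hy⟩ := groupDet_mem_integerGroupDets_klein (a := r 3) (b := sr (0 : ZMod 6))
      (orderOf_eq_prime (by decide) (by decide)) (orderOf_eq_prime (by decide) (by decide))
      (by decide) (by decide) x
    exact hy ▸ sixteen_dvd_groupDet_klein y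
  · exact orderOf_eq_prime (by decide) (by decide)
  · decide
  · decide +kernel
  · decide +kernel
  · decide +kernel

open QuaternionGroup in
theorem isLindLehmerConstant_quaternionGroup_three :
    IsLindLehmerConstant (QuaternionGroup 3) 5 := by
  refine isLindLehmerConstant_five (a := a 2)
    (x := fun
      | a i => (![0, 0, 1, 0, 0, 1] : Fin 6 → ℤ) i
      | xa i => (![0, 0, 1, 0, 1, 1] : Fin 6 → ℤ) i)
    (y := fun
      | a i => (![0, 1, 0, 0, 1, 0] : Fin 6 → ℤ) i
      | xa i => (![1, 1, 0, 1, 0, 0] : Fin 6 → ℤ) i)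
    ?_ ?_ ?_ ?_ ?_ ?_
  · rintro _ ⟨x, rfl⟩
    obtain ⟨y, hy⟩ := groupDet_mem_integerGroupDets_zmod (a := xa (0 : ZMod (2 * 3))) (n := 4)
      (orderOf_eq_prime_pow (p := 2) (n := 1) (by decide) (by decide)) x
    exact hy ▸ sixteen_dvd_groupDet_zmod_four y
  · exact orderOf_eq_prime (by decide) (by decide)
  · decide
  · decide +kernel
  · decide +kernel
  · decide +kernel

theorem isLindLehmerConstant_zmod_twelve :
    IsLindLehmerConstant (Multiplicative (ZMod 12)) 5 := by
  refine isLindLehmerConstant_five (a := .ofAdd 4)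
    -- With `g` a generator, these are `1 + g + ⋯ + g⁴` and `1 + g⁵ + ⋯ + g²⁰`, whose product is
    -- `1 + g + ⋯ + g²⁴`.
    (x := fun i => if i.toAdd.val < 5 then 1 else 0)
    (y := fun i => if (5 * i.toAdd).val < 5 then 1 else 0)
    ?_ ?_ ?_ ?_ ?_ ?_
  · rintro _ ⟨x, rfl⟩
    obtain ⟨y, hy⟩ := groupDet_mem_integerGroupDets_zmod
      (a := (.ofAdd 3 : Multiplicative (ZMod 12))) (n := 4)
      (orderOf_eq_prime_pow (p := 2) (n := 1) (by decide) (by decide)) x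
    exact hy ▸ sixteen_dvd_groupDet_zmod_four y
  · exact orderOf_eq_prime (by decide) (by decide)
  · decide
  · decide +kernel
  · decide +kernel
  · decide +kernel

open Equiv in
theorem isLindLehmerConstant_alternatingGroup_four :
    IsLindLehmerConstant (alternatingGroup (Fin 4)) 5 := by
  refine isLindLehmerConstant_five
    (a := ⟨swap 0 1 * swap 1 2, Perm.mem_alternatingGroup.mpr (by decide)⟩)
    -- An even permutation of four letters is determined by its values at `0` and `1`.
    (x := fun g => !![0, 0, 0, 0; 0, 0, 0, 0; 0, 1, 0, 1; 1, 1, 1, 0] (g.1 0) (g.1 1))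
    (y := fun g => !![0, 0, 1, 0; 1, 0, 0, 0; 0, 1, 0, 1; 0, 1, 0, 0] (g.1 0) (g.1 1))
    ?_ ?_ ?_ ?_ ?_ ?_
  · rintro _ ⟨x, rfl⟩
    obtain ⟨y, hy⟩ := groupDet_mem_integerGroupDets_klein
      (a := (⟨swap 0 1 * swap 2 3, Perm.mem_alternatingGroup.mpr (by decide)⟩ :
        alternatingGroup (Fin 4)))
      (b := ⟨swap 0 2 * swap 1 3, Perm.mem_alternatingGroup.mpr (by decide)⟩)
      (orderOf_eq_prime (by decide) (by decide)) (orderOf_eq_prime (by decide) (by decide))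
      (by decide) (by decide) x
    exact hy ▸ sixteen_dvd_groupDet_klein y
  · exact orderOf_eq_prime (by decide) (by decide)
  · decide +kernel
  · decide +kernel
  · decide +kernel
  · decide +kernel

/-! ### Eisenstein integers -/

/-- The Eisenstein integers `ℤ[ω]`, with `ω² = -1 - ω` and elements `re + im * ω`. -/
abbrev EisensteinInt : Type := QuadraticAlgebra ℤ (-1) (-1)

namespace EisensteinInt

open scoped QuadraticAlgebra

theorem norm_eq (z : EisensteinInt) : z.norm = z.re ^ 2 - z.re * z.im + z.im ^ 2 := by
  rw [QuadraticAlgebra.norm_def]; ring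

/-- Reduction modulo the prime `1 - ω` above `3`, which sends `ω` to `1`. -/
def modSqrtNegThree : EisensteinInt →+* ZMod 3 where
  toFun z := z.re + z.im
  map_one' := by simp
  map_zero' := by simp
  map_add' z w := by simp; ring
  map_mul' z w := by
    have h3 : (3 : ZMod 3) = 0 := rfl
    simp
    linear_combination (-z.im * w.im : ZMod 3) * h3

/-- Every `t` prime to `2` has `t ^ 4` congruent modulo `4` to a power of `ω`, since modulo `2` it
is a unit of the field with four elements, each of which is the residue of a power of `ω`. The
factor `u` is the inverse power of `ω`. -/
theorem exists_pow_four_mul {t : EisensteinInt} (ht : ¬(Even t.re ∧ Even t.im)) :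
    ∃ u v : EisensteinInt, modSqrtNegThree u = 1 ∧ u.norm = 1 ∧ u * t ^ 4 = 1 + 4 * v := by
  obtain ⟨ζ, hζ, hζ0⟩ : ∃ ζ : EisensteinInt, ζ = ⟨0, 1⟩ ∧ ζ ^ 2 = -1 - ζ :=
    ⟨_, rfl, by rw [sq]; ext <;> simp⟩
  have hπ : modSqrtNegThree ζ = 1 := by simp [hζ, modSqrtNegThree]
  have hN : ζ.norm = 1 := by simp [hζ, norm_eq]
  have hζ3 : ζ ^ 3 = 1 := by linear_combination (ζ - 1) * hζ0
  have key : ∀ (k : ℕ) (v : EisensteinInt), t = ζ ^ k * (1 + 2 * v) →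
      ∃ u v : EisensteinInt, modSqrtNegThree u = 1 ∧ u.norm = 1 ∧ u * t ^ 4 = 1 + 4 * v := by
    rintro k v rfl
    refine ⟨(ζ ^ 2) ^ k, 2 * v + 6 * v ^ 2 + 8 * v ^ 3 + 4 * v ^ 4, by simp [hπ],
      by simp [hN], ?_⟩
    have h6 : (ζ ^ 2) ^ k * (ζ ^ k) ^ 4 = 1 := by
      rw [← pow_mul, ← pow_mul, ← pow_add, show 2 * k + k * 4 = 3 * (2 * k) by ring, pow_mul, hζ3,
        one_pow]
    linear_combination (1 + 2 * v) ^ 4 * h6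
  rcases Int.even_or_odd' t.re with ⟨a, ha | ha⟩ <;> rcases Int.even_or_odd' t.im with ⟨b, hb | hb⟩
  · exact absurd ⟨ha ▸ even_two_mul a, hb ▸ even_two_mul b⟩ ht
  · refine key 1 ⟨b - a, -a⟩ ?_
    ext <;> simp [hζ, ha, hb]
    ring
  · refine key 0 ⟨a, b⟩ ?_
    ext <;> simp [ha, hb]
    ring
  · refine key 2 ⟨-b - 1, a - b⟩ ?_
    rw [hζ0]
    ext <;> simp [hζ, ha, hb] <;> ring

end EisensteinInt

/-- The determinant of the Klein four-group, over any commutative ring, is congruent modulo `4` to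
the fourth power of its augmentation. -/
theorem exists_mul_eq_pow_four_add {R : Type*} [CommRing R] (p q r s : R) :
    ∃ k, (p + r + (q + s)) * (p + r - (q + s)) * ((p - r + (q - s)) * (p - r - (q - s))) =
      (p + q + r + s) ^ 4 + 4 * k :=
  ⟨-(q + r + s) * (p + q + r + s) ^ 3 +
    ((q + s) * (r + s) + (r + s) * (q + r) + (q + r) * (q + s)) * (p + q + r + s) ^ 2 -
    2 * (q + s) * (r + s) * (q + r) * (p + q + r + s), by ring⟩

open EisensteinInt in
open scoped QuadraticAlgebra in
/-- The arithmetic behind the constant `11`. Here `A ≡ 1` modulo `4`. Up to a power of `ω`, which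
affects neither the norm nor the residue modulo `1 - ω`, also `U ≡ 1` modulo `4`, so its norm is at
least `12` unless `U` is then a rational integer `ε ≡ 1` modulo `4`. In that case `A ≡ ε` modulo
`3`, which forces `A ≡ 1` modulo `12` if `ε = 1`, and `3 ∣ A` if `ε = -3`; otherwise `|ε|` is at
least `5`. -/
theorem eleven_le_abs_mul_norm {A : ℤ} {U : EisensteinInt} (hA : ∃ s k, A = s ^ 4 + 4 * k)
    (hU : ∃ t k, U = t ^ 4 + 4 * k) (hAU : modSqrtNegThree U = A) (hodd : Odd (A * U.norm))
    (h1 : A * U.norm ≠ 1) : 11 ≤ |A * U.norm| := by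
  rw [Int.odd_mul] at hodd
  obtain ⟨hAodd, hUodd⟩ := hodd
  have hA4 : A % 4 = 1 := by
    obtain ⟨s, k, rfl⟩ := hA
    obtain ⟨m, rfl⟩ : Odd s := by
      simp only [Int.odd_add, Int.odd_pow] at hAodd
      have : Even (4 * k) := ⟨2 * k, by ring⟩
      simpa [this] using hAodd
    have : (2 * m + 1) ^ 4 + 4 * k = 4 * (4 * m ^ 4 + 8 * m ^ 3 + 6 * m ^ 2 + 2 * m + k) + 1 := by
      ring
    omega
  obtain ⟨t, k, rfl⟩ := hU
  have ht : ¬(Even t.re ∧ Even t.im) := by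
    rintro ⟨⟨a, ha⟩, ⟨b, hb⟩⟩
    obtain rfl : t = 2 * ⟨a, b⟩ := by ext <;> simp [ha, hb] <;> ring
    rw [← Int.not_even_iff_odd] at hUodd
    apply hUodd
    rw [show (2 * ⟨a, b⟩ : EisensteinInt) ^ 4 + 4 * k = 2 * (8 * ⟨a, b⟩ ^ 4 + 2 * k) by ring,
      map_mul]
    exact Even.mul_right (by simp [norm_eq]; decide) _
  obtain ⟨u, v, hu, huN, huv⟩ := exists_pow_four_mul ht
  obtain ⟨w, hw⟩ : ∃ w, u * (t ^ 4 + 4 * k) = 1 + 4 * w :=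
    ⟨v + u * k, by linear_combination huv⟩
  have hN : (t ^ 4 + 4 * k).norm = (1 + 4 * w.re) ^ 2 - (1 + 4 * w.re) * (4 * w.im)
      + (4 * w.im) ^ 2 := by
    have h := congrArg QuadraticAlgebra.norm hw
    rw [map_mul, huN, one_mul] at h
    rw [h, norm_eq]
    simp
  have hπ : ((1 + 4 * w.re + 4 * w.im : ℤ) : ZMod 3) = A := by
    rw [← hAU, ← one_mul (modSqrtNegThree _), ← hu, ← map_mul, hw]
    simp [modSqrtNegThree]
  rw [ZMod.intCast_eq_intCast_iff_dvd_sub] at hπ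
  rw [hN] at h1 ⊢
  generalize w.re = m at *
  generalize w.im = n at *
  rw [abs_mul]
  have hApos : 1 ≤ |A| := Int.one_le_abs (by rintro rfl; simp at hA4)
  by_cases hn : n = 0
  · subst hn
    simp only [mul_zero, add_zero, sub_zero, ne_eq, zero_pow two_ne_zero] at h1 hπ ⊢
    rw [abs_of_nonneg (sq_nonneg (1 + 4 * m))]
    rcases lt_trichotomy m (-1) with hm | rfl | hm
    · nlinarith
    · have : 3 ≤ |A| := by
        rcases abs_cases A with h | h <;> push_cast at hπ <;> omega
      norm_num
      linarith
    · obtain rfl | hm : m = 0 ∨ 1 ≤ m := by omega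
      · norm_num at h1 hπ ⊢
        rcases abs_cases A with h | h <;> omega
      · nlinarith
  · have h12 : 12 ≤ (1 + 4 * m) ^ 2 - (1 + 4 * m) * (4 * n) + (4 * n) ^ 2 := by
      have : 1 ≤ n ^ 2 := by have := sq_pos_of_ne_zero hn; omega
      nlinarith [sq_nonneg (2 * n - (1 + 4 * m))]
    rw [abs_of_nonneg (a := (1 + 4 * m) ^ 2 - (1 + 4 * m) * (4 * n) + (4 * n) ^ 2) (by linarith)]
    nlinarith

/-! ### The group `ℤ₆ × ℤ₂` -/

/-- The value at `y ∈ ℤ[C₃]` of the character sending the generator to `ω`, namely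
`y₀ + y₁ ω + y₂ ω²` rewritten with `ω² = -1 - ω`. -/
def eisensteinChar (y : Multiplicative (ZMod 3) → ℤ) : EisensteinInt :=
  ⟨y (.ofAdd 0) - y (.ofAdd 2), y (.ofAdd 1) - y (.ofAdd 2)⟩

theorem groupDet_eq_sum_mul_norm (y : Multiplicative (ZMod 3) → ℤ) :
    groupDet y = (∑ i, y i) * (eisensteinChar y).norm := by
  have h : ∑ i, y i = y (.ofAdd 0) + y (.ofAdd 1) + y (.ofAdd 2) := Fin.sum_univ_three _
  rw [groupDet_multiplicative_zmod_three, h, EisensteinInt.norm_eq, eisensteinChar]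
  ring

theorem modSqrtNegThree_eisensteinChar (y : Multiplicative (ZMod 3) → ℤ) :
    EisensteinInt.modSqrtNegThree (eisensteinChar y) = (∑ i, y i : ℤ) := by
  have h : ∑ i, y i = y (.ofAdd 0) + y (.ofAdd 1) + y (.ofAdd 2) := Fin.sum_univ_three _
  have h3 : (3 : ZMod 3) = 0 := rfl
  rw [h]
  simp [EisensteinInt.modSqrtNegThree, eisensteinChar]
  linear_combination (-y (.ofAdd 2) : ZMod 3) * h3

theorem eisensteinChar_add (y z : Multiplicative (ZMod 3) → ℤ) :
    eisensteinChar (y + z) = eisensteinChar y + eisensteinChar z := by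
  ext <;> simp [eisensteinChar] <;> ring

theorem eisensteinChar_sub (y z : Multiplicative (ZMod 3) → ℤ) :
    eisensteinChar (y - z) = eisensteinChar y - eisensteinChar z := by
  ext <;> simp [eisensteinChar] <;> ring

/-- Decomposing along the four characters of the Klein four-group, and then along the two
irreducible rational representations of `C₃`, writes the determinant as `A * norm U`, where `A` and
`U` are determinants of the Klein four-group over `ℤ` and over the Eisenstein integers. -/
theorem eleven_le_abs_groupDet
    (x : (Multiplicative (ZMod 3) × Multiplicative (ZMod 2)) × Multiplicative (ZMod 2) → ℤ)
    (hodd : Odd (groupDet x)) (h1 : groupDet x ≠ 1) : 11 ≤ |groupDet x| := by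
  let p : Multiplicative (ZMod 3) → ℤ := fun k => x ((k, .ofAdd 0), .ofAdd 0)
  let q : Multiplicative (ZMod 3) → ℤ := fun k => x ((k, .ofAdd 1), .ofAdd 0)
  let r : Multiplicative (ZMod 3) → ℤ := fun k => x ((k, .ofAdd 0), .ofAdd 1)
  let s : Multiplicative (ZMod 3) → ℤ := fun k => x ((k, .ofAdd 1), .ofAdd 1)
  have hD : groupDet x = groupDet (p + r + (q + s)) * groupDet (p + r - (q + s)) *
      (groupDet (p - r + (q - s)) * groupDet (p - r - (q - s))) := by
    rw [groupDet_prod_two, groupDet_prod_two, groupDet_prod_two]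
    rfl
  replace hD : groupDet x = ((∑ i, (p + r + (q + s)) i) * (∑ i, (p + r - (q + s)) i) *
        ((∑ i, (p - r + (q - s)) i) * (∑ i, (p - r - (q - s)) i))) *
      (eisensteinChar (p + r + (q + s)) * eisensteinChar (p + r - (q + s)) *
        (eisensteinChar (p - r + (q - s)) * eisensteinChar (p - r - (q - s)))).norm := by
    rw [hD]
    simp only [groupDet_eq_sum_mul_norm, map_mul]
    ring
  rw [hD] at hodd h1 ⊢
  refine eleven_le_abs_mul_norm ?_ ?_ ?_ hodd h1
  · simp only [Pi.add_apply, Pi.sub_apply, Finset.sum_add_distrib, Finset.sum_sub_distrib]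
    exact ⟨_, exists_mul_eq_pow_four_add _ _ _ _⟩
  · simp only [eisensteinChar_add, eisensteinChar_sub]
    exact ⟨_, exists_mul_eq_pow_four_add _ _ _ _⟩
  · simp only [map_mul, modSqrtNegThree_eisensteinChar, Int.cast_mul]

theorem isLindLehmerConstant_zmod_six_prod_zmod_two :
    IsLindLehmerConstant (Multiplicative (ZMod 6 × ZMod 2)) 11 := by
  -- The element `1 - N`, with `N` the sum of all group elements, has determinant `1 - 12`.
  have hdet : groupDet (fun g : Multiplicative (ZMod 6 × ZMod 2) => (if g = 1 then 1 else 0) + -1)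
      = -11 := by
    rw [groupDet_one_add_const]
    simp
  refine ⟨⟨-11, ⟨_, hdet⟩, by norm_num⟩, ?_⟩
  rintro _ ⟨_, ⟨x, rfl⟩, h0, h1, h1', rfl⟩
  by_cases h2 : 2 ∣ groupDet x
  · obtain ⟨y, hy⟩ := groupDet_mem_integerGroupDets_klein
      (a := (.ofAdd (3, 0) : Multiplicative (ZMod 6 × ZMod 2))) (b := .ofAdd (0, 1))
      (orderOf_eq_prime (by decide) (by decide)) (orderOf_eq_prime (by decide) (by decide))
      (by decide) (by decide) x
    have h16 : 16 ∣ groupDet x := hy ▸ sixteen_dvd_groupDet_klein y (hy ▸ h2)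
    have := Int.le_of_dvd (abs_pos.mpr h0) ((dvd_abs _ _).mpr h16)
    linarith
  · let f : (Multiplicative (ZMod 3) × Multiplicative (ZMod 2)) × Multiplicative (ZMod 2) →*
        Multiplicative (ZMod 6 × ZMod 2) :=
      MonoidHom.mk' (fun p => .ofAdd (2 * p.1.1.toAdd.val + 3 * p.1.2.toAdd.val, p.2.toAdd))
        (by decide +kernel)
    obtain ⟨y, hy⟩ := groupDet_mem_integerGroupDets_of_injective f (by decide +kernel) x
    rw [← hy] at h1 h2 ⊢
    exact eleven_le_abs_groupDet y (Int.not_even_iff_odd.mp (even_iff_two_dvd.not.mpr h2)) h1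

theorem mainTheorem7 :
    IsLindLehmerConstant (DihedralGroup 6) 5 ∧
    IsLindLehmerConstant (QuaternionGroup 3) 5 ∧
    IsLindLehmerConstant (Multiplicative (ZMod 12)) 5 ∧
    IsLindLehmerConstant (alternatingGroup (Fin 4)) 5 ∧
    IsLindLehmerConstant (Multiplicative (ZMod 6 × ZMod 2)) 11 :=
  ⟨isLindLehmerConstant_dihedralGroup_six, isLindLehmerConstant_quaternionGroup_three,
    isLindLehmerConstant_zmod_twelve, isLindLehmerConstant_alternatingGroup_four,
    isLindLehmerConstant_zmod_six_prod_zmod_two⟩
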